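/- **Convergence of tabular Q-learning with shared experience (DASE).** Let $(\mathcal S,\mathcal A,p,r)$ be a finite Markov decision process with transition probabilities $p(s'\mid s,a)$ and a deterministic reward function $r(s,a)$, let $\gamma\in[0,1)$, and let $Q^*(s,a)=\sup_\pi Q^\pi(s,a)$, where $Q^\pi(s,a)=\mathbb E_\pi\big[\sum_{k\ge 0}\gamma^k r(s_k,a_k)\mid s_0=s,\,a_0=a\big]$ and $\pi$ ranges over the stationary (possibly randomized) policies. There are $K$ agents; fix one of them, $i$. On a probability space with an increasing sequence of $\sigma$-fields $(\mathcal P_t)_{t\ge 0}$, at its update step $t=0,1,2,\dots$ agent $i$ processes a batch of transitions $(s_{t,b},a_{t,b},r(s_{t,b},a_{t,b}),s'_{t,b})$, $b\in B$, with $B$ a finite index set (a single transition per step is the case $|B|=1$). Transition $b$ was executed by agent $j_{t,b}$; it is called internal if $j_{t,b}=i$ and external otherwise. It has a learning rate $\eta_{t,b}\in[0,1]$ and a similarity (DPS) weight $\lambda_{t,b}\in[0,1]$; put $w_{t,b}=1$ for internal and $w_{t,b}=\lambda_{t,b}$ for external transitions. The initial table $Q_0$ is $\mathcal P_0$-measurable,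 $j_{t,b},s_{t,b},a_{t,b},\eta_{t,b},\lambda_{t,b}$ are $\mathcal P_t$-measurable and $s'_{t,b}$ is $\mathcal P_{t+1}$-measurable. The table of agent $i$ is updated, for all $(s,a)\in\mathcal S\times\mathcal A$, by $$Q_{t+1}(s,a)=Q_t(s,a)+\frac1{|B|}\sum_{b\,:\,(s_{t,b},a_{t,b})=(s,a)}\eta_{t,b}\,w_{t,b}\Big[r(s,a)+\gamma\max_{a'\in\mathcal A}Q_t(s'_{t,b},a')-Q_t(s,a)\Big].$$ Assume: 1. (Sampling) Internal and external transitions are samples of the same MDP: $\mathbb P(s'_{t,b}=y\mid\mathcal P_t)=p(y\mid s_{t,b},a_{t,b})$ almost surely, for all $t,b,y$. 2. (Robbins–Monro; infinitely many updates) For every $(s,a)\in\mathcal S\times\mathcal A$, almost surely, $$\sum_{t}\ \sum_{b\,:\,(s_{t,b},a_{t,b})=(s,a),\ j_{t,b}=i}\eta_{t,b}=\infty,\qquad \sum_{t}\ \sum_{b\,:\,(s_{t,b},a_{t,b})=(s,a)}\eta_{t,b}^2<\infty .$$ In particular every state–action pair is visited and updated infinitely often by internal transitions. Then, almost surely, $Q_t(s,a)\to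 Q^*(s,a)$ as $t\to\infty$ for all $(s,a)\in\mathcal S\times\mathcal A$. -/

import Mathlib

open MeasureTheory ProbabilityTheory Filter Topology

/-- A finite Markov decision process `(S, A, p, r)` with transition probabilities
`p s a s' = p(s' | s, a)` and a deterministic reward function `r`. -/
structure FiniteMDP (S A : Type*) [Fintype S] where
  /-- transition probabilities -/
  p : S → A → S → ℝ
  /-- reward function -/
  r : S → A → ℝ
  p_nonneg : ∀ s a s', 0 ≤ p s a s'
  p_sum : ∀ s a, ∑ s', p s a s' = 1

/-- A (stationary, possibly randomized) policy: `prob s a = π(a | s)`. Deterministic policies are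
the ones with values in `{0, 1}`. -/
structure Policy (S A : Type*) [Fintype A] where
  /-- action probabilities -/
  prob : S → A → ℝ
  prob_nonneg : ∀ s a, 0 ≤ prob s a
  prob_sum : ∀ s, ∑ a, prob s a = 1

namespace FiniteMDP

variable {S A : Type*} [Fintype S] [Fintype A] [DecidableEq S] [DecidableEq A]

/-- The transition matrix of the Markov chain `(s_t, a_t)` of state-action pairs under the policy
`π`, that is `s_{t+1} ∼ p(· | s_t, a_t)` and `a_{t+1} ∼ π(· | s_{t+1})`. The entry `(x, y)` of its
`t`-th power is the probability that `(s_t, a_t) = y` given `(s_0, a_0) = x`. -/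
def stepMatrix (M : FiniteMDP S A) (π : Policy S A) : Matrix (S × A) (S × A) ℝ :=
  Matrix.of fun x y => M.p x.1 x.2 y.1 * π.prob y.1 y.2

/-- The action-value function of `π`: the expected discounted return
`Q^π(s, a) = ∑_t γ^t 𝔼[r(s_t, a_t) | s_0 = s, a_0 = a]`. -/
noncomputable def qPolicy (M : FiniteMDP S A) (γ : ℝ) (π : Policy S A) (s : S) (a : A) : ℝ :=
  ∑' t : ℕ, γ ^ t * ∑ y : S × A, (M.stepMatrix π ^ t) (s, a) y * M.r y.1 y.2

/-- The optimal action-value function `Q^*(s, a) = sup_π Q^π(s, a)`. -/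
noncomputable def qStar (M : FiniteMDP S A) (γ : ℝ) (s : S) (a : A) : ℝ :=
  ⨆ π : Policy S A, M.qPolicy γ π s a

/-- The temporal-difference error `r(s, a) + γ max_{a'} Q(s', a') - Q(s, a)` of the table `Q` on
the transition `(s, a, r(s, a), s')`. -/
noncomputable def tdError [Nonempty A] (M : FiniteMDP S A) (γ : ℝ) (Q : S → A → ℝ)
    (s : S) (a : A) (s' : S) : ℝ :=
  M.r s a + γ * Finset.univ.sup' Finset.univ_nonempty (Q s') - Q s a

/-- The weight that agent `i` gives to a transition executed by agent `j`: internal transitions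
have weight `1`, external ones are weighted by their similarity weight `lam`. -/
def shareWeight {K : ℕ} (i j : Fin K) (lam : ℝ) : ℝ :=
  if j = i then 1 else lam

/-- One tabular Q-learning update of agent `i` with shared experience, from the table `Q` and a
batch of transitions indexed by `B`. The transition `b` was executed by the agent `owner b`; it went
from the state `st b` under the action `ac b` to the state `nx b`; its learning rate is `η b` and
its similarity weight `lam b`. The temporal-difference errors of internal transitions and the
weighted ones of external transitions are averaged over the batch, each acting on the table entry
of its own state-action pair. -/
noncomputable def daseStep [Nonempty A] {K : ℕ} {B : Type*} [Fintype B]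
    (M : FiniteMDP S A) (γ : ℝ) (i : Fin K) (owner : B → Fin K) (st : B → S) (ac : B → A)
    (nx : B → S) (η lam : B → ℝ) (Q : S → A → ℝ) (s : S) (a : A) : ℝ :=
  Q s a + (Fintype.card B : ℝ)⁻¹ * ∑ b : B,
    if st b = s ∧ ac b = a then
      η b * shareWeight i (owner b) (lam b) * M.tdError γ Q s a (nx b)
    else 0

end FiniteMDP

/-! Each update is a relaxed Bellman step plus noise: with `α` the total coefficient acting on an
entry, `Q (t+1) - Q t = α (T Q - Q) + noise`, where `T` is the Bellman optimality operator, a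
`γ`-contraction in sup norm. Similarity weights lie in `[0, 1]`, so external transitions cannot
spoil square-summability, and they only add to `α`, whose sum already diverges through internal
transitions.

By `daseStep_sub_bellman_eq` the noise is a finite sum, over batch index and state `y`, of a
predictable coefficient times the martingale difference `1{s' = y} - p(y | s, a)`. Tables are
bounded along each path (`abs_daseStep_le`), so the coefficients are almost surely square-summable
and the accumulated noise converges (`ae_exists_tendsto_sum_of_summable_sq`).

The rest is pathwise. Subtracting from `Q` the accumulated noise minus its limit leaves a recursion
whose only error is a vanishing perturbation of the target. Contraction then shrinks the eventual
bound on the distance to the fixed point by a fixed factor, repeatedly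
(`tendsto_zero_of_asynchronous_contraction`). The fixed point is `qStar` by `bellman_qStar`. -/

/-! ### Deterministic averaging recursions -/

/-- Recursive averaging with non-summable weights forgets the initial value. -/
theorem eventually_le_add_of_averaging {α x : ℕ → ℝ} {c : ℝ} (hα : ∀ t, α t ∈ Set.Icc (0 : ℝ) 1)
    (hdiv : Tendsto (fun n => ∑ t ∈ Finset.range n, α t) atTop atTop)
    (hx : ∀ᶠ t in atTop, x (t + 1) ≤ (1 - α t) * x t + α t * c) {ε : ℝ} (hε : 0 < ε) :
    ∀ᶠ t in atTop, x t ≤ c + ε := by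
  obtain ⟨N, hN⟩ := eventually_atTop.1 hx
  set D : ℝ := |x N - c|
  -- This iterates `1 - α ≤ exp (-α)` from time `N`; the exponent is minus the sum of `α` over `[N,
  -- t)`.
  have key : ∀ t, N ≤ t → x t - c ≤ D *
      Real.exp (∑ u ∈ Finset.range N, α u - ∑ u ∈ Finset.range t, α u) := by
    intro t ht
    induction t, ht using Nat.le_induction with
    | base => simpa [D] using le_abs_self (x N - c)
    | succ t ht ih =>
      have h1 : 1 - α t ≤ Real.exp (-α t) := by linarith [Real.add_one_le_exp (-α t)]
      have h2 : 0 ≤ 1 - α t := by linarith [(hα t).2]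
      have h3 : x (t + 1) - c ≤ (1 - α t) * (x t - c) := by linarith [hN t ht]
      rw [Finset.sum_range_succ, show ∀ a b c : ℝ, a - (b + c) = (a - b) + -c by intros; ring,
        Real.exp_add]
      set E := Real.exp (∑ u ∈ Finset.range N, α u - ∑ u ∈ Finset.range t, α u)
      calc x (t + 1) - c ≤ (1 - α t) * (x t - c) := h3
        _ ≤ (1 - α t) * (D * E) := by gcongr
        _ ≤ Real.exp (-α t) * (D * E) := by gcongr
        _ = D * (E * Real.exp (-α t)) := by ring
  have hlim : Tendsto (fun t => D *
      Real.exp (∑ u ∈ Finset.range N, α u - ∑ u ∈ Finset.range t, α u)) atTop (𝓝 0) := by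
    have : Tendsto (fun t => ∑ u ∈ Finset.range N, α u - ∑ u ∈ Finset.range t, α u)
        atTop atBot := by
      simpa [sub_eq_add_neg] using tendsto_atBot_add_const_left atTop
        (∑ u ∈ Finset.range N, α u) (tendsto_neg_atTop_atBot.comp hdiv)
    simpa using (Real.tendsto_exp_atBot.comp this).const_mul D
  filter_upwards [hlim.eventually (gt_mem_nhds hε), eventually_ge_atTop N] with t h1 h2
  linarith [key t h2]

/-- Convergence of asynchronous stochastic approximation for a sup-norm contraction, after the
noise has been absorbed in a vanishing perturbation. -/
theorem tendsto_zero_of_asynchronous_contraction {X : Type*} [Finite X] {α z : ℕ → X → ℝ}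
    {ε : ℕ → ℝ} {γ C : ℝ} (hγ0 : 0 ≤ γ) (hγ1 : γ < 1) (hα : ∀ t x, α t x ∈ Set.Icc (0 : ℝ) 1)
    (hdiv : ∀ x, Tendsto (fun n => ∑ t ∈ Finset.range n, α t x) atTop atTop)
    (hz0 : ∀ t x, 0 ≤ z t x) (hzC : ∀ t x, z t x ≤ C) (hε : Tendsto ε atTop (𝓝 0))
    (hz : ∀ t c, (∀ x, z t x ≤ c) → ∀ x,
      z (t + 1) x ≤ (1 - α t x) * z t x + α t x * (γ * c + ε t)) (x : X) :
    Tendsto (fun t => z t x) atTop (𝓝 0) := by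
  -- The gap `(1 - γ) * c` is split: a quarter absorbs the perturbation and a quarter the slack of
  -- averaging, and `γ + (1 - γ) / 2 = (1 + γ) / 2`.
  have step : ∀ c > 0, (∀ᶠ t in atTop, ∀ x, z t x ≤ c) →
      ∀ᶠ t in atTop, ∀ x, z t x ≤ (1 + γ) / 2 * c := by
    intro c hc h
    rw [eventually_all]
    intro x
    have hδ : 0 < (1 - γ) / 4 * c := by
      have : 0 < 1 - γ := by linarith
      positivity
    have : ∀ᶠ t in atTop, z (t + 1) x ≤ (1 - α t x) * z t x +
        α t x * (γ * c + (1 - γ) / 4 * c) := by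
      filter_upwards [h, hε.eventually (gt_mem_nhds hδ)] with t h1 h2
      refine (hz t c h1 x).trans ?_
      have := (hα t x).1
      gcongr
    filter_upwards [eventually_le_add_of_averaging (x := fun t => z t x) (fun t => hα t x)
      (hdiv x) this hδ] with t ht
    linarith
  -- The added `1` keeps every bound of the iteration strictly positive, as `step` requires.
  have hD : 0 < |C| + 1 := by positivity
  have hk : 0 < (1 + γ) / 2 := by linarith
  have iter : ∀ n : ℕ, ∀ᶠ t in atTop, ∀ x, z t x ≤ ((1 + γ) / 2) ^ n * (|C| + 1) := by
    intro n
    induction n with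
    | zero =>
      exact Eventually.of_forall fun t x => by
        rw [pow_zero, one_mul]; linarith [hzC t x, le_abs_self C]
    | succ n ih =>
      have := step _ (by positivity) ih
      simpa only [pow_succ', mul_assoc] using this
  have hpow : Tendsto (fun n : ℕ => ((1 + γ) / 2) ^ n * (|C| + 1)) atTop (𝓝 0) := by
    simpa using (tendsto_pow_atTop_nhds_zero_of_lt_one hk.le (by linarith)).mul_const (|C| + 1)
  rw [Metric.tendsto_atTop']
  intro δ hδ
  obtain ⟨n, hn⟩ := (hpow.eventually (gt_mem_nhds hδ)).exists
  obtain ⟨N, hN⟩ := eventually_atTop.1 (iter n)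
  refine ⟨N, fun t ht => ?_⟩
  rw [Real.dist_eq, sub_zero, abs_of_nonneg (hz0 t x)]
  exact (hN t ht.le x).trans_lt hn

/-! ### Inequalities for maxima and averages -/

theorem Finset.abs_sup'_sub_sup'_le {ι : Type*} {s : Finset ι} (hs : s.Nonempty) {f g : ι → ℝ}
    {c : ℝ} (h : ∀ i ∈ s, |f i - g i| ≤ c) : |s.sup' hs f - s.sup' hs g| ≤ c := by
  rw [abs_sub_le_iff]
  constructor
  · rw [sub_le_iff_le_add]
    refine Finset.sup'_le _ _ fun i hi => ?_
    linarith [(abs_sub_le_iff.1 (h i hi)).1, Finset.le_sup' g hi]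
  · rw [sub_le_iff_le_add]
    refine Finset.sup'_le _ _ fun i hi => ?_
    linarith [(abs_sub_le_iff.1 (h i hi)).2, Finset.le_sup' f hi]

theorem Finset.abs_sup'_le {ι : Type*} {s : Finset ι} (hs : s.Nonempty) {f : ι → ℝ}
    {c : ℝ} (h : ∀ i ∈ s, |f i| ≤ c) : |s.sup' hs f| ≤ c := by
  obtain ⟨i, hi, h'⟩ := s.exists_mem_eq_sup' hs f
  rw [h']
  exact h i hi

/-- A weighted average of numbers of absolute value at most `c` has absolute value at most `c`. -/
theorem abs_sum_mul_le_of_sum_eq_one {ι : Type*} [Fintype ι] {w f : ι → ℝ} {c : ℝ}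
    (hw : ∀ i, 0 ≤ w i) (hw1 : ∑ i, w i = 1) (hf : ∀ i, |f i| ≤ c) : |∑ i, w i * f i| ≤ c :=
  calc |∑ i, w i * f i| ≤ ∑ i, |w i * f i| := Finset.abs_sum_le_sum_abs _ _
    _ ≤ ∑ i, w i * c := Finset.sum_le_sum fun i _ => by
        rw [abs_mul, abs_of_nonneg (hw i)]
        exact mul_le_mul_of_nonneg_left (hf i) (hw i)
    _ = c := by rw [← Finset.sum_mul, hw1, one_mul]

/-- A function that dominates its discounted average is nonnegative. -/
theorem nonneg_of_discounted_average_le {X : Type*} [Fintype X] {P : Matrix X X ℝ} {γ : ℝ}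
    {f : X → ℝ} (hP : ∀ x y, 0 ≤ P x y) (hP1 : ∀ x, ∑ y, P x y = 1) (hγ0 : 0 ≤ γ) (hγ1 : γ < 1)
    (hf : ∀ x, γ * ∑ y, P x y * f y ≤ f x) (x : X) : 0 ≤ f x := by
  have : Nonempty X := ⟨x⟩
  -- Minimum principle: at a minimum the average is at least `f x₀`, whence `(1 - γ) * f x₀ ≥ 0`.
  obtain ⟨x₀, h₀⟩ := Finite.exists_min f
  have h1 : f x₀ ≤ ∑ y, P x₀ y * f y :=
    calc f x₀ = ∑ y, P x₀ y * f x₀ := by rw [← Finset.sum_mul, hP1, one_mul]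
      _ ≤ _ := Finset.sum_le_sum fun y _ => mul_le_mul_of_nonneg_left (h₀ y) (hP _ _)
  have h2 := hf x₀
  have h3 : γ * f x₀ ≤ f x₀ := (mul_le_mul_of_nonneg_left h1 hγ0).trans h2
  refine le_trans ?_ (h₀ x)
  by_contra! h
  nlinarith

/-! ### The Bellman operator and its fixed point -/

namespace FiniteMDP

variable {S A : Type*} [Fintype S] [Fintype A]

/-- The Bellman optimality operator. -/
noncomputable def bellman [Nonempty A] (M : FiniteMDP S A) (γ : ℝ) (Q : S → A → ℝ)
    (s : S) (a : A) : ℝ :=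
  M.r s a + γ * ∑ y, M.p s a y * Finset.univ.sup' Finset.univ_nonempty (Q y)

theorem abs_bellman_sub_bellman_le [Nonempty A] (M : FiniteMDP S A) {γ : ℝ} (hγ0 : 0 ≤ γ)
    {Q Q' : S → A → ℝ} {c : ℝ} (h : ∀ s a, |Q s a - Q' s a| ≤ c) (s : S) (a : A) :
    |M.bellman γ Q s a - M.bellman γ Q' s a| ≤ γ * c := by
  have : M.bellman γ Q s a - M.bellman γ Q' s a = γ * ∑ y, M.p s a y *
      (Finset.univ.sup' Finset.univ_nonempty (Q y) -
        Finset.univ.sup' Finset.univ_nonempty (Q' y)) := by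
    simp only [bellman, mul_sub, Finset.sum_sub_distrib]
    ring
  rw [this, abs_mul, abs_of_nonneg hγ0]
  exact mul_le_mul_of_nonneg_left (abs_sum_mul_le_of_sum_eq_one (M.p_nonneg s a) (M.p_sum s a)
    fun y => Finset.abs_sup'_sub_sup'_le _ fun a' _ => h y a') hγ0

theorem exists_bellman_eq_self [Nonempty A] (M : FiniteMDP S A) {γ : ℝ} (hγ0 : 0 ≤ γ)
    (hγ1 : γ < 1) : ∃ q : S → A → ℝ, M.bellman γ q = q := by
  have hc : ContractingWith ⟨γ, hγ0⟩ (M.bellman γ) := by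
    refine ⟨hγ1, LipschitzWith.of_dist_le_mul fun Q Q' => ?_⟩
    have h0 : 0 ≤ γ * dist Q Q' := by positivity
    refine (dist_pi_le_iff h0).2 fun s => (dist_pi_le_iff h0).2 fun a => ?_
    rw [Real.dist_eq]
    refine M.abs_bellman_sub_bellman_le hγ0 (fun s a => ?_) s a
    rw [← Real.dist_eq]
    exact (dist_le_pi_dist (Q s) (Q' s) a).trans (dist_le_pi_dist Q Q' s)
  exact ⟨_, hc.fixedPoint_isFixedPt⟩

theorem stepMatrix_nonneg (M : FiniteMDP S A) (π : Policy S A) (x y : S × A) :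
    0 ≤ M.stepMatrix π x y :=
  mul_nonneg (M.p_nonneg _ _ _) (π.prob_nonneg _ _)

theorem sum_stepMatrix_mul (M : FiniteMDP S A) (π : Policy S A) (x : S × A) (f : S × A → ℝ) :
    ∑ y, M.stepMatrix π x y * f y = ∑ s, M.p x.1 x.2 s * ∑ a, π.prob s a * f (s, a) := by
  simp [stepMatrix, Fintype.sum_prod_type, Finset.mul_sum, mul_assoc]

theorem sum_stepMatrix (M : FiniteMDP S A) (π : Policy S A) (x : S × A) :
    ∑ y, M.stepMatrix π x y = 1 := by
  have := M.sum_stepMatrix_mul π x fun _ => 1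
  simpa [π.prob_sum, M.p_sum] using this

variable [DecidableEq S] [DecidableEq A]

theorem abs_stepMatrix_pow_mulVec_le (M : FiniteMDP S A) (π : Policy S A) {f : S × A → ℝ} {c : ℝ}
    (hf : ∀ x, |f x| ≤ c) (t : ℕ) (x : S × A) : |∑ y, (M.stepMatrix π ^ t) x y * f y| ≤ c := by
  induction t generalizing x with
  | zero => simpa [Matrix.one_apply] using hf x
  | succ t ih =>
    have : ∑ y, (M.stepMatrix π ^ (t + 1)) x y * f y =
        ∑ z, M.stepMatrix π x z * ∑ y, (M.stepMatrix π ^ t) z y * f y := by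
      simp only [pow_succ', Matrix.mul_apply, Finset.sum_mul, Finset.mul_sum, mul_assoc]
      exact Finset.sum_comm
    rw [this]
    exact abs_sum_mul_le_of_sum_eq_one (M.stepMatrix_nonneg π x) (M.sum_stepMatrix π x) ih

/-- The Bellman equation of a policy. -/
theorem qPolicy_eq (M : FiniteMDP S A) {γ : ℝ} (hγ0 : 0 ≤ γ) (hγ1 : γ < 1) (π : Policy S A)
    (x : S × A) : M.qPolicy γ π x.1 x.2 =
      M.r x.1 x.2 + γ * ∑ y, M.stepMatrix π x y * M.qPolicy γ π y.1 y.2 := by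
  obtain ⟨c, hc⟩ : ∃ c, ∀ y : S × A, |M.r y.1 y.2| ≤ c :=
    ⟨∑ y : S × A, |M.r y.1 y.2|, fun y => Finset.single_le_sum
      (f := fun y : S × A => |M.r y.1 y.2|) (fun _ _ => abs_nonneg _) (Finset.mem_univ y)⟩
  have hs : ∀ x : S × A, Summable fun t : ℕ =>
      γ ^ t * ∑ y : S × A, (M.stepMatrix π ^ t) x y * M.r y.1 y.2 := by
    intro x
    refine Summable.of_norm_bounded
      ((summable_geometric_of_lt_one hγ0 hγ1).mul_right c) fun t => ?_
    rw [Real.norm_eq_abs, abs_mul, abs_of_nonneg (pow_nonneg hγ0 t)]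
    exact mul_le_mul_of_nonneg_left (M.abs_stepMatrix_pow_mulVec_le π hc t x) (pow_nonneg hγ0 t)
  unfold qPolicy
  rw [(hs x).tsum_eq_zero_add]
  congr 1
  · simp [Matrix.one_apply]
  · simp only [← tsum_mul_left]
    rw [← Summable.tsum_finsetSum fun y _ => (hs y).mul_left _, ← tsum_mul_left]
    congr 1
    ext t
    simp only [pow_succ', Matrix.mul_apply, Finset.sum_mul, Finset.mul_sum]
    rw [Finset.sum_comm]
    exact Finset.sum_congr rfl fun _ _ => Finset.sum_congr rfl fun _ _ => by ring

/-- The optimal action-value function solves the Bellman optimality equation. -/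
theorem bellman_qStar [Nonempty A] (M : FiniteMDP S A) {γ : ℝ} (hγ0 : 0 ≤ γ) (hγ1 : γ < 1) :
    M.bellman γ (M.qStar γ) = M.qStar γ := by
  obtain ⟨q, hq⟩ := M.exists_bellman_eq_self hγ0 hγ1
  suffices M.qStar γ = q by rw [this, hq]
  -- The maximum dominates every policy average, so `q - Q^π` dominates its discounted average under
  -- `π`.
  have le_q : ∀ π s a, M.qPolicy γ π s a ≤ q s a := by
    intro π s a
    have := nonneg_of_discounted_average_le (f := fun x => q x.1 x.2 - M.qPolicy γ π x.1 x.2)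
      (M.stepMatrix_nonneg π) (M.sum_stepMatrix π) hγ0 hγ1 (fun x => ?_) (s, a)
    · exact sub_nonneg.1 this
    rw [M.qPolicy_eq hγ0 hγ1 π x]
    have h1 : ∑ y, M.stepMatrix π x y * q y.1 y.2 ≤
        ∑ y, M.p x.1 x.2 y * Finset.univ.sup' Finset.univ_nonempty (q y) := by
      rw [M.sum_stepMatrix_mul π x fun y => q y.1 y.2]
      refine Finset.sum_le_sum fun s _ => mul_le_mul_of_nonneg_left ?_ (M.p_nonneg _ _ _)
      calc ∑ a, π.prob s a * q s a
          ≤ ∑ a, π.prob s a * Finset.univ.sup' Finset.univ_nonempty (q s) :=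
            Finset.sum_le_sum fun a _ => mul_le_mul_of_nonneg_left
              (Finset.le_sup' (q s) (Finset.mem_univ a)) (π.prob_nonneg _ _)
        _ = _ := by rw [← Finset.sum_mul, π.prob_sum, one_mul]
    have h2 : q x.1 x.2 = M.r x.1 x.2 +
        γ * ∑ y, M.p x.1 x.2 y * Finset.univ.sup' Finset.univ_nonempty (q y) :=
      (congrFun (congrFun hq x.1) x.2).symm
    rw [h2]
    simp only [mul_sub, Finset.sum_sub_distrib]
    have := mul_le_mul_of_nonneg_left h1 hγ0
    linarith
  -- For the greedy policy of `q` the maximum is the policy average, so the same principle gives the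
  -- reverse inequality.
  choose g _ hg using fun s => Finset.univ.exists_mem_eq_sup' Finset.univ_nonempty (q s)
  let π : Policy S A :=
    { prob := fun s a => if a = g s then 1 else 0
      prob_nonneg := fun s a => by split_ifs <;> norm_num
      prob_sum := fun s => by simp }
  have q_le : ∀ s a, q s a ≤ M.qPolicy γ π s a := by
    intro s a
    have := nonneg_of_discounted_average_le (f := fun x => M.qPolicy γ π x.1 x.2 - q x.1 x.2)
      (M.stepMatrix_nonneg π) (M.sum_stepMatrix π) hγ0 hγ1 (fun x => ?_) (s, a)
    · exact sub_nonneg.1 this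
    rw [M.qPolicy_eq hγ0 hγ1 π x]
    have h1 : ∑ y, M.stepMatrix π x y * q y.1 y.2 =
        ∑ y, M.p x.1 x.2 y * Finset.univ.sup' Finset.univ_nonempty (q y) := by
      rw [M.sum_stepMatrix_mul π x fun y => q y.1 y.2]
      simp [π, hg]
    have h2 : q x.1 x.2 = M.r x.1 x.2 +
        γ * ∑ y, M.p x.1 x.2 y * Finset.univ.sup' Finset.univ_nonempty (q y) :=
      (congrFun (congrFun hq x.1) x.2).symm
    rw [h2, ← h1]
    simp only [mul_sub, Finset.sum_sub_distrib]
    linarith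
  have : Nonempty (Policy S A) := ⟨π⟩
  ext s a
  refine le_antisymm (ciSup_le fun π => le_q π s a) ((q_le s a).trans ?_)
  exact le_ciSup (f := fun π => M.qPolicy γ π s a) ⟨q s a, by rintro _ ⟨π, rfl⟩; exact le_q π s a⟩ π

end FiniteMDP

/-! ### Convergence of martingale transforms -/

/-- Pulling a bounded factor known at time `t` out of a bounded martingale difference. -/
theorem condExp_mul_eq_zero {Ω : Type*} {m mΩ : MeasurableSpace Ω} {μ : Measure Ω}
    [IsFiniteMeasure μ] (hm : m ≤ mΩ) {g d : Ω → ℝ} {C D : ℝ} (hg : Measurable[m] g)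
    (hd : Measurable d) (hgC : ∀ ω, |g ω| ≤ C) (hdD : ∀ ω, |d ω| ≤ D) (h0 : μ[d | m] =ᵐ[μ] 0) :
    μ[fun ω => g ω * d ω | m] =ᵐ[μ] 0 := by
  have hdi : Integrable d μ :=
    Integrable.of_bound hd.aestronglyMeasurable D (Eventually.of_forall hdD)
  have hgd : Integrable (g * d) μ :=
    hdi.bdd_mul (hg.mono hm le_rfl).aestronglyMeasurable (Eventually.of_forall hgC)
  have := condExp_mul_of_stronglyMeasurable_left hg.stronglyMeasurable hgd hdi
  filter_upwards [this, h0] with ω h1 h2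
  change μ[g * d | m] ω = 0
  rw [h1, Pi.mul_apply, h2]
  simp

/-- Orthogonality of the increments bounds the second moments of the partial sums by `C`; the
martingale is therefore bounded in `L¹` and Doob's convergence theorem applies. -/
theorem ae_exists_tendsto_sum_of_sum_sq_le {Ω : Type*} {mΩ : MeasurableSpace Ω} {μ : Measure Ω}
    [IsProbabilityMeasure μ] {ℱ : Filtration ℕ mΩ} {g d : ℕ → Ω → ℝ} {C : ℝ}
    (hg : ∀ t, Measurable[ℱ t] (g t)) (hd : ∀ t, Measurable[ℱ (t + 1)] (d t))
    (hd1 : ∀ t ω, |d t ω| ≤ 1) (h0 : ∀ t, μ[d t | ℱ t] =ᵐ[μ] 0)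
    (hC : ∀ n ω, ∑ t ∈ Finset.range n, g t ω ^ 2 ≤ C) :
    ∀ᵐ ω ∂μ, ∃ L, Tendsto (fun n => ∑ t ∈ Finset.range n, g t ω * d t ω) atTop (𝓝 L) := by
  -- A crude bound from `|x| ≤ 1 + x ^ 2`, serving only integrability and the extraction of factors
  -- from conditional expectations.
  have hgC : ∀ t ω, |g t ω| ≤ C + 1 := by
    intro t ω
    have h1 : g t ω ^ 2 ≤ C := (Finset.single_le_sum (f := fun t => g t ω ^ 2)
      (fun _ _ => sq_nonneg _) (Finset.self_mem_range_succ t)).trans (hC (t + 1) ω)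
    have := sq_abs (g t ω)
    nlinarith [sq_nonneg (|g t ω| - 1)]
  have hd' : ∀ t, Measurable (d t) := fun t => (hd t).mono (ℱ.le _) le_rfl
  have hg' : ∀ t, Measurable (g t) := fun t => (hg t).mono (ℱ.le _) le_rfl
  set X : ℕ → Ω → ℝ := fun n ω => ∑ t ∈ Finset.range n, g t ω * d t ω with hX
  have hXm : ∀ n, Measurable[ℱ n] (X n) := by
    intro n
    refine Finset.measurable_sum _ fun t ht => ?_
    have : t + 1 ≤ n := Finset.mem_range.1 ht
    exact ((hg t).mono (ℱ.mono (by omega)) le_rfl).mul ((hd t).mono (ℱ.mono this) le_rfl)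
  have hXm' : ∀ n, Measurable (X n) := fun n => (hXm n).mono (ℱ.le _) le_rfl
  have hgd : ∀ t ω, |g t ω * d t ω| ≤ C + 1 := by
    intro t ω
    rw [abs_mul]
    exact (mul_le_of_le_one_right (abs_nonneg _) (hd1 t ω)).trans (hgC t ω)
  have hXC : ∀ n ω, |X n ω| ≤ n * (C + 1) := by
    intro n ω
    refine (Finset.abs_sum_le_sum_abs _ _).trans
      ((Finset.sum_le_sum fun t _ => hgd t ω).trans ?_)
    simp [mul_add]
  have hXi : ∀ n, Integrable (X n) μ := fun n =>
    Integrable.of_bound (hXm' n).aestronglyMeasurable _ (Eventually.of_forall (hXC n))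
  have hmart : Martingale X ℱ μ := by
    refine martingale_of_condExp_sub_eq_zero_nat (fun n => (hXm n).stronglyMeasurable) hXi ?_
    intro t
    have : X (t + 1) - X t = fun ω => g t ω * d t ω := by
      ext ω
      simp [hX, Finset.sum_range_succ]
    rw [this]
    exact condExp_mul_eq_zero (ℱ.le t) (hg t) (hd' t) (hgC t) (hd1 t) (h0 t)
  have int_of_bdd : ∀ {f : Ω → ℝ} {D : ℝ}, Measurable f → (∀ ω, |f ω| ≤ D) → Integrable f μ :=
    fun hf h => Integrable.of_bound hf.aestronglyMeasurable _ (Eventually.of_forall h)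
  have hsqi : ∀ n, Integrable (fun ω => X n ω ^ 2) μ := fun n =>
    int_of_bdd (D := (n * (C + 1)) ^ 2) ((hXm' n).pow_const 2) fun ω => by
      rw [abs_pow]
      exact pow_le_pow_left₀ (abs_nonneg _) (hXC n ω) 2
  have hgsqi : ∀ t, Integrable (fun ω => g t ω ^ 2) μ := fun n =>
    int_of_bdd (D := (C + 1) ^ 2) ((hg' n).pow_const 2) fun ω => by
      rw [abs_pow]
      exact pow_le_pow_left₀ (abs_nonneg _) (hgC n ω) 2
  have hcross : ∀ t, ∫ ω, X t ω * g t ω * d t ω ∂μ = 0 := by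
    intro t
    have h := condExp_mul_eq_zero (C := t * (C + 1) * (C + 1)) (ℱ.le t) ((hXm t).mul (hg t)) (hd' t)
      (fun ω => by
        rw [Pi.mul_apply, abs_mul]
        exact mul_le_mul (hXC t ω) (hgC t ω) (abs_nonneg _)
          ((abs_nonneg _).trans (hXC t ω))) (hd1 t) (h0 t)
    have h2 := integral_condExp (μ := μ) (ℱ.le t) (f := fun ω => (X t * g t) ω * d t ω)
    rw [integral_congr_ae h] at h2
    simpa using h2.symm
  have hvar : ∀ n, ∫ ω, X n ω ^ 2 ∂μ ≤ ∫ ω, ∑ t ∈ Finset.range n, g t ω ^ 2 ∂μ := by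
    intro n
    induction n with
    | zero => simp [hX]
    | succ n ih =>
      have hci : Integrable (fun ω => 2 * (X n ω * g n ω * d n ω)) μ :=
        (int_of_bdd (D := n * (C + 1) * (C + 1)) (((hXm' n).mul (hg' n)).mul (hd' n)) fun ω => by
          simp only [Pi.mul_apply]
          rw [mul_assoc, abs_mul]
          exact mul_le_mul (hXC n ω) (hgd n ω) (abs_nonneg _)
            ((abs_nonneg _).trans (hXC n ω))).const_mul 2
      calc ∫ ω, X (n + 1) ω ^ 2 ∂μ
          ≤ ∫ ω, (X n ω ^ 2 + 2 * (X n ω * g n ω * d n ω)) + g n ω ^ 2 ∂μ := by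
            refine integral_mono (hsqi _) (((hsqi n).add hci).add (hgsqi n)) fun ω => ?_
            have h1 : X (n + 1) ω = X n ω + g n ω * d n ω := by
              simp [hX, Finset.sum_range_succ]
            have h2 : d n ω ^ 2 ≤ 1 := (sq_le_one_iff_abs_le_one _).2 (hd1 n ω)
            simp only [h1]
            nlinarith [sq_nonneg (g n ω)]
        _ = ∫ ω, X n ω ^ 2 ∂μ + ∫ ω, g n ω ^ 2 ∂μ := by
            have h1 := integral_add ((hsqi n).add hci) (hgsqi n)
            have h2 := integral_add (hsqi n) hci
            rw [integral_const_mul, hcross, mul_zero, add_zero] at h2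
            simp only [Pi.add_apply] at h1
            rw [h1, h2]
        _ ≤ ∫ ω, ∑ t ∈ Finset.range n, g t ω ^ 2 ∂μ + ∫ ω, g n ω ^ 2 ∂μ := by gcongr
        _ = _ := by
            simp only [Finset.sum_range_succ]
            rw [integral_add (integrable_finsetSum _ fun t _ => hgsqi t) (hgsqi n)]
  have hvarC : ∀ n, ∫ ω, X n ω ^ 2 ∂μ ≤ C := fun n => (hvar n).trans <| by
    calc _ ≤ ∫ _, C ∂μ := integral_mono (integrable_finsetSum _ fun t _ => hgsqi t)
            (integrable_const C) (hC n)
      _ = C := by simp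
  have hL1 : ∀ n, eLpNorm (X n) 1 μ ≤ (Real.toNNReal (1 + C) : ENNReal) := by
    intro n
    rw [eLpNorm_one_eq_lintegral_enorm, ← ofReal_integral_norm_eq_lintegral_enorm (hXi n)]
    refine ENNReal.ofReal_le_ofReal ?_
    calc ∫ ω, ‖X n ω‖ ∂μ ≤ ∫ ω, 1 + X n ω ^ 2 ∂μ := by
          refine integral_mono (hXi n).norm ((integrable_const 1).add (hsqi n)) fun ω => ?_
          simp only [Real.norm_eq_abs]
          have := sq_abs (X n ω)
          nlinarith [sq_nonneg (|X n ω| - 1)]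
      _ ≤ 1 + C := by
          rw [integral_add (integrable_const 1) (hsqi n)]
          simpa using hvarC n
  filter_upwards [hmart.submartingale.ae_tendsto_limitProcess hL1] with ω h
  exact ⟨_, h⟩

/-- A martingale transform converges almost surely where the squares of its predictable
coefficients are summable. -/
theorem ae_exists_tendsto_sum_of_summable_sq {Ω : Type*} {mΩ : MeasurableSpace Ω} {μ : Measure Ω}
    [IsProbabilityMeasure μ] {ℱ : Filtration ℕ mΩ} {g d : ℕ → Ω → ℝ}
    (hg : ∀ t, Measurable[ℱ t] (g t)) (hd : ∀ t, Measurable[ℱ (t + 1)] (d t))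
    (hd1 : ∀ t ω, |d t ω| ≤ 1) (h0 : ∀ t, μ[d t | ℱ t] =ᵐ[μ] 0)
    (hs : ∀ᵐ ω ∂μ, Summable fun t => g t ω ^ 2) :
    ∀ᵐ ω ∂μ, ∃ L, Tendsto (fun n => ∑ t ∈ Finset.range n, g t ω * d t ω) atTop (𝓝 L) := by
  -- The test includes `g t` itself: it remains `ℱ t`-measurable, and the retained squares sum to at
  -- most `C`. Once `C` exceeds the full sum of squares of a path, nothing is dropped there;
  -- countably many `C` suffice.
  have key : ∀ C : ℕ, ∀ᵐ ω ∂μ, ∃ L, Tendsto (fun n => ∑ t ∈ Finset.range n,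
      (if ∑ u ∈ Finset.range (t + 1), g u ω ^ 2 ≤ C then g t ω else 0) * d t ω) atTop (𝓝 L) := by
    intro C
    refine ae_exists_tendsto_sum_of_sum_sq_le (C := C) (ℱ := ℱ) (fun t => ?_) hd hd1 h0
      fun n ω => ?_
    · refine Measurable.ite (measurableSet_le (Finset.measurable_sum _ fun u hu => ?_)
        measurable_const) (hg t) measurable_const
      exact ((hg u).mono (ℱ.mono (Nat.lt_succ_iff.1 (Finset.mem_range.1 hu))) le_rfl).pow_const 2
    · induction n with
      | zero => simp
      | succ n ih =>
        by_cases h : ∑ u ∈ Finset.range (n + 1), g u ω ^ 2 ≤ C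
        · refine (Finset.sum_le_sum fun t _ => ?_).trans h
          split_ifs
          · exact le_rfl
          · simpa using sq_nonneg _
        · rw [Finset.sum_range_succ, if_neg h]
          simpa using ih
  filter_upwards [ae_all_iff.2 key, hs] with ω h1 h2
  obtain ⟨C, hC⟩ := exists_nat_ge (∑' t, g t ω ^ 2)
  obtain ⟨L, hL⟩ := h1 C
  refine ⟨L, hL.congr fun n => Finset.sum_congr rfl fun t _ => ?_⟩
  rw [if_pos ((h2.sum_le_tsum _ fun _ _ => sq_nonneg _).trans hC)]

/-! ### Size and measurability of the update coefficients -/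

namespace FiniteMDP

theorem measurable_sup'_table {S A : Type*} [Fintype A] [Nonempty A] {Ω : Type*} {m : MeasurableSpace Ω} {Q : Ω → S → A → ℝ}
    (hQ : ∀ s a, Measurable fun ω => Q ω s a) (y : S) :
    Measurable fun ω => Finset.univ.sup' Finset.univ_nonempty (Q ω y) := by
  have := Finset.measurable_sup' (s := (Finset.univ : Finset A)) Finset.univ_nonempty
    (f := fun a ω => Q ω y a) fun a _ => hQ y a
  convert this using 1
  ext ω
  simp [Finset.sup'_apply]

theorem p_le_one {S A : Type*} [Fintype S] (M : FiniteMDP S A) (s : S) (a : A) (y : S) : M.p s a y ≤ 1 :=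
  M.p_sum s a ▸ Finset.single_le_sum (f := M.p s a) (fun y _ => M.p_nonneg s a y)
    (Finset.mem_univ y)

section Coefficients

variable {S A : Type*} [DecidableEq S] [DecidableEq A]

/-- The coefficient with which transition `b` of a batch acts on the table entry `(s, a)`. -/
noncomputable def stepCoeff {K : ℕ} {B : Type*} [Fintype B] (i : Fin K) (owner : B → Fin K)
    (st : B → S) (ac : B → A) (η lam : B → ℝ) (b : B) (s : S) (a : A) : ℝ :=
  (Fintype.card B : ℝ)⁻¹ *
    if st b = s ∧ ac b = a then η b * shareWeight i (owner b) (lam b) else 0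

variable {K : ℕ} {B : Type*} [Fintype B] {i : Fin K} {owner : B → Fin K} {st : B → S} {ac : B → A}
  {η lam : B → ℝ}

theorem shareWeight_mem_Icc {j : Fin K} {l : ℝ} (hl : l ∈ Set.Icc (0 : ℝ) 1) :
    shareWeight i j l ∈ Set.Icc (0 : ℝ) 1 := by
  unfold shareWeight
  split_ifs
  · simp
  · exact hl

theorem stepCoeff_nonneg (hη : ∀ b, η b ∈ Set.Icc (0 : ℝ) 1) (hlam : ∀ b, lam b ∈ Set.Icc (0 : ℝ) 1)
    (b : B) (s : S) (a : A) : 0 ≤ stepCoeff i owner st ac η lam b s a := by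
  have := (hη b).1
  have := (shareWeight_mem_Icc (i := i) (j := owner b) (hlam b)).1
  unfold stepCoeff
  split_ifs <;> positivity

theorem stepCoeff_le (hη : ∀ b, η b ∈ Set.Icc (0 : ℝ) 1) (hlam : ∀ b, lam b ∈ Set.Icc (0 : ℝ) 1)
    (b : B) (s : S) (a : A) : stepCoeff i owner st ac η lam b s a ≤
      (Fintype.card B : ℝ)⁻¹ * if st b = s ∧ ac b = a then η b else 0 := by
  unfold stepCoeff
  gcongr
  split_ifs
  · exact mul_le_of_le_one_right (hη b).1 (shareWeight_mem_Icc (hlam b)).2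
  · exact le_rfl

theorem sum_stepCoeff_mem_Icc (hη : ∀ b, η b ∈ Set.Icc (0 : ℝ) 1)
    (hlam : ∀ b, lam b ∈ Set.Icc (0 : ℝ) 1) (s : S) (a : A) :
    ∑ b, stepCoeff i owner st ac η lam b s a ∈ Set.Icc (0 : ℝ) 1 := by
  refine ⟨Finset.sum_nonneg fun b _ => stepCoeff_nonneg hη hlam b s a, ?_⟩
  calc _ ≤ ∑ _b : B, (Fintype.card B : ℝ)⁻¹ * 1 := by
        refine Finset.sum_le_sum fun b _ => (stepCoeff_le hη hlam b s a).trans ?_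
        gcongr
        split_ifs
        · exact (hη b).2
        · exact zero_le_one
    _ ≤ 1 := by simpa using mul_inv_le_one

theorem stepCoeff_sq_le (hη : ∀ b, η b ∈ Set.Icc (0 : ℝ) 1)
    (hlam : ∀ b, lam b ∈ Set.Icc (0 : ℝ) 1) (b : B) (s : S) (a : A) :
    stepCoeff i owner st ac η lam b s a ^ 2 ≤
      ∑ b, if st b = s ∧ ac b = a then η b ^ 2 else 0 := by
  have h0 : (0 : ℝ) ≤ if st b = s ∧ ac b = a then η b else 0 := by
    split_ifs
    · exact (hη b).1
    · exact le_rfl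
  have h1 := (stepCoeff_le (i := i) (owner := owner) (st := st) (ac := ac) hη hlam b s a).trans
    (mul_le_of_le_one_left h0 (Nat.cast_inv_le_one _))
  have h2 := pow_le_pow_left₀ (stepCoeff_nonneg hη hlam b s a) h1 2
  rw [ite_pow, zero_pow two_ne_zero] at h2
  refine h2.trans (Finset.single_le_sum (f := fun b => if st b = s ∧ ac b = a then η b ^ 2 else 0)
    (fun b _ => ?_) (Finset.mem_univ b))
  split_ifs
  · exact sq_nonneg _
  · exact le_rfl

/-- Internal transitions have weight exactly `1` and external ones contribute nonnegatively, so
divergence needs no lower bound on the similarity weights. -/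
theorem mul_sum_internal_le_sum_stepCoeff (hη : ∀ b, η b ∈ Set.Icc (0 : ℝ) 1)
    (hlam : ∀ b, lam b ∈ Set.Icc (0 : ℝ) 1) (s : S) (a : A) :
    (Fintype.card B : ℝ)⁻¹ * ∑ b, (if owner b = i ∧ st b = s ∧ ac b = a then η b else 0) ≤
      ∑ b, stepCoeff i owner st ac η lam b s a := by
  rw [Finset.mul_sum]
  refine Finset.sum_le_sum fun b _ => ?_
  by_cases h : owner b = i ∧ st b = s ∧ ac b = a
  · simp [stepCoeff, shareWeight, h]
  · rw [if_neg h, mul_zero]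
    exact stepCoeff_nonneg hη hlam b s a

theorem measurable_stepCoeff {Ω : Type*} {m : MeasurableSpace Ω} {K : ℕ} {B : Type*} [Fintype B]
    {i : Fin K} {owner : B → Ω → Fin K} {st : B → Ω → S} {ac : B → Ω → A} {η lam : B → Ω → ℝ}
    (howner : ∀ b, Measurable[m, ⊤] (owner b)) (hst : ∀ b, Measurable[m, ⊤] (st b))
    (hac : ∀ b, Measurable[m, ⊤] (ac b)) (hη : ∀ b, Measurable (η b))
    (hlam : ∀ b, Measurable (lam b)) (b : B) (s : S) (a : A) :
    Measurable fun ω => stepCoeff i (fun b => owner b ω) (fun b => st b ω) (fun b => ac b ω)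
      (fun b => η b ω) (fun b => lam b ω) b s a := by
  have h1 : MeasurableSet {ω | st b ω = s} := hst b (show MeasurableSet[⊤] {s} from trivial)
  have h2 : MeasurableSet {ω | ac b ω = a} := hac b (show MeasurableSet[⊤] {a} from trivial)
  have h3 : MeasurableSet {ω | owner b ω = i} := howner b (show MeasurableSet[⊤] {i} from trivial)
  refine Measurable.const_mul (Measurable.ite (h1.inter h2) ?_ measurable_const) _
  exact (hη b).mul (Measurable.ite h3 measurable_const (hlam b))

end Coefficients

/-! ### Pathwise convergence given convergent noise -/

variable {S A : Type*} [Fintype S] [Fintype A] [DecidableEq S] [DecidableEq A]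

/-- Asynchronous stochastic value iteration with bounded iterates converges on each path on which
the accumulated noise converges. -/
theorem tendsto_qStar_of_tendsto_sum_noise [Nonempty A] (M : FiniteMDP S A) {γ : ℝ}
    (hγ0 : 0 ≤ γ) (hγ1 : γ < 1) {Q α : ℕ → S → A → ℝ} {C : ℝ} (hQC : ∀ t s a, |Q t s a| ≤ C)
    (hα : ∀ t s a, α t s a ∈ Set.Icc (0 : ℝ) 1)
    (hdiv : ∀ s a, Tendsto (fun n => ∑ t ∈ Finset.range n, α t s a) atTop atTop)
    (hnoise : ∀ s a, ∃ L, Tendsto (fun n => ∑ t ∈ Finset.range n,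
      (Q (t + 1) s a - Q t s a - α t s a * (M.bellman γ (Q t) s a - Q t s a))) atTop (𝓝 L))
    (s : S) (a : A) : Tendsto (fun t => Q t s a) atTop (𝓝 (M.qStar γ s a)) := by
  choose L hL using hnoise
  set q := M.qStar γ
  have hfix : M.bellman γ q = q := M.bellman_qStar hγ0 hγ1
  -- Subtracting the limit makes `D` vanish at infinity, while its increments are exactly the noise;
  -- `Q - D` thus follows a recursion without noise terms.
  set D : ℕ → S → A → ℝ := fun n s a => ∑ t ∈ Finset.range n,
    (Q (t + 1) s a - Q t s a - α t s a * (M.bellman γ (Q t) s a - Q t s a)) - L s a with hD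
  have hD0 : ∀ s a, Tendsto (fun t => D t s a) atTop (𝓝 0) := fun s a => by
    simpa only [sub_self] using (hL s a).sub_const (L s a)
  set E : ℕ → ℝ := fun t => ∑ x : S × A, |D t x.1 x.2| with hE
  have hE0 : Tendsto E atTop (𝓝 0) := by
    simpa using tendsto_finsetSum Finset.univ fun (x : S × A) _ => (hD0 x.1 x.2).abs
  have hDE : ∀ t s a, |D t s a| ≤ E t := fun t s a =>
    Finset.single_le_sum (f := fun x : S × A => |D t x.1 x.2|) (fun _ _ => abs_nonneg _)
      (Finset.mem_univ (s, a))
  obtain ⟨C₁, hC₁⟩ := hE0.bddAbove_range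
  have hz : Tendsto (fun t => |Q t s a - D t s a - q s a|) atTop (𝓝 0) := by
    refine tendsto_zero_of_asynchronous_contraction (X := S × A)
      (z := fun t x => |Q t x.1 x.2 - D t x.1 x.2 - q x.1 x.2|) (α := fun t x => α t x.1 x.2)
      (ε := fun t => 2 * E t) (C := C + C₁ + ∑ x : S × A, |q x.1 x.2|) hγ0 hγ1
      (fun t x => hα t _ _) (fun x => hdiv _ _) (fun t x => abs_nonneg _) (fun t x => ?_)
      (by simpa using hE0.const_mul 2) (fun t c hc x => ?_) (s, a)
    · have h1 := hQC t x.1 x.2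
      have h2 := (hDE t x.1 x.2).trans (hC₁ ⟨t, rfl⟩)
      have h3 : |q x.1 x.2| ≤ ∑ x : S × A, |q x.1 x.2| :=
        Finset.single_le_sum (f := fun x : S × A => |q x.1 x.2|) (fun _ _ => abs_nonneg _)
          (Finset.mem_univ x)
      exact (abs_sub _ _).trans (add_le_add ((abs_sub _ _).trans (add_le_add h1 h2)) h3)
    · obtain ⟨s, a⟩ := x
      have h1 : ∀ s a, |Q t s a - q s a| ≤ c + E t := fun s a => by
        have := abs_add_le (Q t s a - D t s a - q s a) (D t s a)
        rw [show Q t s a - D t s a - q s a + D t s a = Q t s a - q s a by ring] at this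
        exact this.trans (add_le_add (hc (s, a)) (hDE t s a))
      have h2 := M.abs_bellman_sub_bellman_le hγ0 h1 s a
      rw [hfix] at h2
      have hE' : 0 ≤ E t := Finset.sum_nonneg fun _ _ => abs_nonneg _
      -- One `E t` comes from evaluating the operator at `Q` rather than `Q - D` (using `γ ≤ 1`),
      -- the other from relaxing towards `Q - D`.
      have h3 : |M.bellman γ (Q t) s a - q s a - D t s a| ≤ γ * c + 2 * E t := by
        refine (abs_sub _ _).trans ((add_le_add h2 (hDE t s a)).trans ?_)
        nlinarith
      have h4 : Q (t + 1) s a - D (t + 1) s a - q s a = (1 - α t s a) *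
          (Q t s a - D t s a - q s a) + α t s a *
            (M.bellman γ (Q t) s a - q s a - D t s a) := by
        simp only [hD, Finset.sum_range_succ]
        ring
      obtain ⟨h5, h6⟩ := hα t s a
      simp only [h4]
      refine (abs_add_le _ _).trans ?_
      rw [abs_mul, abs_mul, abs_of_nonneg h5, abs_of_nonneg (sub_nonneg.2 h6)]
      gcongr
  have h := (((tendsto_zero_iff_abs_tendsto_zero _).2 hz).add (hD0 s a)).add_const (q s a)
  simp only [zero_add] at h
  exact h.congr fun t => by ring

/-! ### One update as a noisy Bellman step -/

section Step

variable {K : ℕ} {B : Type*} [Fintype B] {i : Fin K} {owner : B → Fin K} {st : B → S} {ac : B → A}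
  {η lam : B → ℝ}

theorem daseStep_eq [Nonempty A] (M : FiniteMDP S A) (γ : ℝ) (nx : B → S) (Q : S → A → ℝ) (s : S)
    (a : A) : M.daseStep γ i owner st ac nx η lam Q s a =
      Q s a + ∑ b, stepCoeff i owner st ac η lam b s a * M.tdError γ Q s a (nx b) := by
  simp only [daseStep, stepCoeff, Finset.mul_sum, mul_assoc, ite_mul, zero_mul]

/-- The new entry is a convex combination of the old entry and the sampled targets, all of which lie
in `[-C, C]`. -/
theorem abs_daseStep_le [Nonempty A] (M : FiniteMDP S A) {γ : ℝ} (hγ0 : 0 ≤ γ)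
    (hη : ∀ b, η b ∈ Set.Icc (0 : ℝ) 1) (hlam : ∀ b, lam b ∈ Set.Icc (0 : ℝ) 1) (nx : B → S)
    {Q : S → A → ℝ} {C : ℝ} (hQ : ∀ s a, |Q s a| ≤ C) (hC : ∀ s a, |M.r s a| + γ * C ≤ C) (s : S)
    (a : A) : |M.daseStep γ i owner st ac nx η lam Q s a| ≤ C := by
  set c := fun b => stepCoeff i owner st ac η lam b s a with hc
  have h1 : M.daseStep γ i owner st ac nx η lam Q s a = (1 - ∑ b, c b) * Q s a +
      ∑ b, c b * (M.r s a + γ * Finset.univ.sup' Finset.univ_nonempty (Q (nx b))) := by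
    rw [daseStep_eq]
    simp only [tdError, mul_sub, Finset.sum_sub_distrib, ← Finset.sum_mul, hc]
    ring
  have h2 : ∀ b, |M.r s a + γ * Finset.univ.sup' Finset.univ_nonempty (Q (nx b))| ≤ C := by
    intro b
    refine (abs_add_le _ _).trans (le_trans ?_ (hC s a))
    rw [abs_mul, abs_of_nonneg hγ0]
    gcongr
    exact Finset.abs_sup'_le _ fun a' _ => hQ _ a'
  have h3 : ∑ b, c b ∈ Set.Icc (0 : ℝ) 1 := sum_stepCoeff_mem_Icc hη hlam s a
  rw [h1]
  calc _ ≤ |(1 - ∑ b, c b) * Q s a| +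
        ∑ b, |c b * (M.r s a + γ * Finset.univ.sup' Finset.univ_nonempty (Q (nx b)))| :=
        (abs_add_le _ _).trans (by gcongr; exact Finset.abs_sum_le_sum_abs _ _)
    _ ≤ (1 - ∑ b, c b) * C + ∑ b, c b * C := by
        refine add_le_add ?_ (Finset.sum_le_sum fun b _ => ?_)
        · rw [abs_mul, abs_of_nonneg (sub_nonneg.2 h3.2)]
          exact mul_le_mul_of_nonneg_left (hQ s a) (sub_nonneg.2 h3.2)
        · have h4 : 0 ≤ c b := stepCoeff_nonneg hη hlam b s a
          rw [abs_mul, abs_of_nonneg h4]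
          exact mul_le_mul_of_nonneg_left (h2 b) h4
    _ = C := by rw [← Finset.sum_mul]; ring

/-- The noise of an update is a combination of the deviations of the sampled next states from
their transition probabilities. -/
theorem daseStep_sub_bellman_eq [Nonempty A] (M : FiniteMDP S A) (γ : ℝ) (nx : B → S)
    (Q : S → A → ℝ) (s : S) (a : A) :
    M.daseStep γ i owner st ac nx η lam Q s a - Q s a -
        (∑ b, stepCoeff i owner st ac η lam b s a) * (M.bellman γ Q s a - Q s a) =
      ∑ b, ∑ y, γ * stepCoeff i owner st ac η lam b s a *
        Finset.univ.sup' Finset.univ_nonempty (Q y) *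
          ((if nx b = y then 1 else 0) - M.p (st b) (ac b) y) := by
  rw [daseStep_eq, add_sub_cancel_left, Finset.sum_mul, ← Finset.sum_sub_distrib]
  refine Finset.sum_congr rfl fun b _ => ?_
  -- If `b` acts on `(s, a)`, its transition law is the one in the Bellman operator there; otherwise
  -- its coefficient is zero.
  by_cases h : st b = s ∧ ac b = a
  · obtain ⟨rfl, rfl⟩ := h
    simp only [tdError, bellman, mul_sub, Finset.sum_sub_distrib, mul_ite, mul_one, mul_zero,
      Finset.sum_ite_eq, Finset.mem_univ, if_true]
    have h := Finset.sum_congr (s₁ := Finset.univ) rfl fun y _ => show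
      stepCoeff i owner st ac η lam b (st b) (ac b) * (γ * (M.p (st b) (ac b) y *
        Finset.univ.sup' Finset.univ_nonempty (Q y))) = γ *
          stepCoeff i owner st ac η lam b (st b) (ac b) *
            Finset.univ.sup' Finset.univ_nonempty (Q y) * M.p (st b) (ac b) y by ring
    simp only [mul_add, Finset.mul_sum]
    linear_combination -h
  · simp [stepCoeff, h]

end Step

theorem measurable_daseStep [Nonempty A] (M : FiniteMDP S A) (γ : ℝ) {Ω : Type*}
    {m : MeasurableSpace Ω} {K : ℕ} {B : Type*} [Fintype B]
    {i : Fin K} {owner : B → Ω → Fin K} {st : B → Ω → S} {ac : B → Ω → A} {nx : B → Ω → S}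
    {η lam : B → Ω → ℝ}
    (howner : ∀ b, Measurable[m, ⊤] (owner b)) (hst : ∀ b, Measurable[m, ⊤] (st b))
    (hac : ∀ b, Measurable[m, ⊤] (ac b)) (hnx : ∀ b, Measurable[m, ⊤] (nx b))
    (hη : ∀ b, Measurable (η b)) (hlam : ∀ b, Measurable (lam b))
    {Q : Ω → S → A → ℝ} (hQ : ∀ s a, Measurable fun ω => Q ω s a) (s : S) (a : A) :
    Measurable fun ω => M.daseStep γ i (fun b => owner b ω) (fun b => st b ω) (fun b => ac b ω)
      (fun b => nx b ω) (fun b => η b ω) (fun b => lam b ω) (Q ω) s a := by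
  have hV : ∀ b, Measurable fun ω => Finset.univ.sup' Finset.univ_nonempty (Q ω (nx b ω)) := by
    intro b
    -- Splitting over the finitely many values of the random next state reduces measurability to
    -- fixed states.
    have : (fun ω => Finset.univ.sup' Finset.univ_nonempty (Q ω (nx b ω))) = fun ω =>
        ∑ y, if nx b ω = y then Finset.univ.sup' Finset.univ_nonempty (Q ω y) else 0 := by
      ext ω
      simp
    rw [this]
    exact Finset.measurable_sum _ fun y _ => Measurable.ite
      (hnx b (show MeasurableSet[⊤] {y} from trivial)) (measurable_sup'_table hQ y)
        measurable_const
  simp only [daseStep_eq, tdError]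
  exact (hQ s a).add (Finset.measurable_sum _ fun b _ =>
    (measurable_stepCoeff howner hst hac hη hlam b s a).mul
      ((((hV b).const_mul γ).const_add _).sub (hQ s a)))

theorem measurable_p_comp (M : FiniteMDP S A) {Ω : Type*} {m : MeasurableSpace Ω} {st : Ω → S}
    {ac : Ω → A} (hst : Measurable[m, ⊤] st) (hac : Measurable[m, ⊤] ac) (y : S) :
    Measurable fun ω => M.p (st ω) (ac ω) y := by
  have : (fun ω => M.p (st ω) (ac ω) y) =
      fun ω => ∑ s, ∑ a, if st ω = s ∧ ac ω = a then M.p s a y else 0 := by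
    ext ω
    simp [ite_and]
  rw [this]
  refine Finset.measurable_sum _ fun s _ => Finset.measurable_sum _ fun a _ =>
    Measurable.ite (MeasurableSet.inter (hst (show MeasurableSet[⊤] {s} from trivial))
      (hac (show MeasurableSet[⊤] {a} from trivial))) measurable_const measurable_const

end FiniteMDP

/-! ### Almost sure convergence -/

theorem theorem1 {S A B Ω : Type*} [Fintype S] [DecidableEq S] [Fintype A] [DecidableEq A]
    [Nonempty A] [Fintype B] {mΩ : MeasurableSpace Ω} (μ : Measure Ω) [IsProbabilityMeasure μ]
    (M : FiniteMDP S A) (γ : ℝ) (hγ0 : 0 ≤ γ) (hγ1 : γ < 1)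
    -- the `K` agents, and the agent whose table is studied
    (K : ℕ) (i : Fin K)
    -- the information available at the update steps
    (ℱ : Filtration ℕ mΩ)
    -- the batch of update step `t`: executing agent, state, action, next state, learning rate,
    -- similarity weight
    (owner : ℕ → B → Ω → Fin K) (st : ℕ → B → Ω → S) (ac : ℕ → B → Ω → A) (nx : ℕ → B → Ω → S)
    (η lam : ℕ → B → Ω → ℝ)
    (howner : ∀ t b, Measurable[ℱ t, ⊤] (owner t b))
    (hst : ∀ t b, Measurable[ℱ t, ⊤] (st t b))
    (hac : ∀ t b, Measurable[ℱ t, ⊤] (ac t b))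
    (hη : ∀ t b, Measurable[ℱ t] (η t b))
    (hlam : ∀ t b, Measurable[ℱ t] (lam t b))
    (hnx : ∀ t b, Measurable[ℱ (t + 1), ⊤] (nx t b))
    -- internal and external transitions are samples of the same MDP
    (hsample : ∀ t b y, μ[Set.indicator {ω | nx t b ω = y} (fun _ => (1 : ℝ)) | ℱ t]
      =ᵐ[μ] fun ω => M.p (st t b ω) (ac t b ω) y)
    (hlam01 : ∀ t b ω, lam t b ω ∈ Set.Icc (0 : ℝ) 1)
    -- Robbins-Monro conditions on the learning rates
    (hη01 : ∀ t b ω, η t b ω ∈ Set.Icc (0 : ℝ) 1)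
    (hdiv : ∀ s a, ∀ᵐ ω ∂μ, Tendsto (fun n => ∑ t ∈ Finset.range n, ∑ b,
      if owner t b ω = i ∧ st t b ω = s ∧ ac t b ω = a then η t b ω else 0) atTop atTop)
    (hsq : ∀ s a, ∀ᵐ ω ∂μ, Summable (fun t => ∑ b,
      if st t b ω = s ∧ ac t b ω = a then η t b ω ^ 2 else 0))
    -- the table of agent `i`
    (Q : ℕ → Ω → S → A → ℝ)
    (hQ0 : ∀ s a, Measurable[ℱ 0] (fun ω => Q 0 ω s a))
    (hQ : ∀ t ω, Q (t + 1) ω = M.daseStep γ i (fun b => owner t b ω) (fun b => st t b ω)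
      (fun b => ac t b ω) (fun b => nx t b ω) (fun b => η t b ω) (fun b => lam t b ω) (Q t ω)) :
    ∀ᵐ ω ∂μ, ∀ s a, Tendsto (fun t => Q t ω s a) atTop (𝓝 (M.qStar γ s a)) := by
  have hQm : ∀ t s a, Measurable[ℱ t] fun ω => Q t ω s a := by
    intro t
    induction t with
    | zero => exact hQ0
    | succ t ih =>
      intro s a
      simp only [hQ]
      have hle := ℱ.mono t.le_succ
      exact M.measurable_daseStep γ (fun b => (howner t b).mono hle le_rfl)
        (fun b => (hst t b).mono hle le_rfl) (fun b => (hac t b).mono hle le_rfl) (hnx t)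
        (fun b => (hη t b).mono hle le_rfl) (fun b => (hlam t b).mono hle le_rfl)
        (fun s a => (ih s a).mono hle le_rfl) s a
  -- The bound may depend on `ω`, as the initial table need not be uniformly bounded. The value `R /
  -- (1 - γ)` is the threshold above which `R + γ * C ≤ C`.
  have hbdd : ∀ ω, ∃ C, ∀ t s a, |Q t ω s a| ≤ C := by
    intro ω
    have h1 : 0 < 1 - γ := by linarith
    set R := ∑ x : S × A, |M.r x.1 x.2|
    set Z := ∑ x : S × A, |Q 0 ω x.1 x.2|
    have hR : ∀ s a, |M.r s a| ≤ R := fun s a =>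
      Finset.single_le_sum (f := fun x : S × A => |M.r x.1 x.2|) (fun _ _ => abs_nonneg _)
        (Finset.mem_univ (s, a))
    have hZ : ∀ s a, |Q 0 ω s a| ≤ Z := fun s a =>
      Finset.single_le_sum (f := fun x : S × A => |Q 0 ω x.1 x.2|) (fun _ _ => abs_nonneg _)
        (Finset.mem_univ (s, a))
    refine ⟨max Z (R / (1 - γ)), fun t => ?_⟩
    induction t with
    | zero => exact fun s a => (hZ s a).trans (le_max_left _ _)
    | succ t ih =>
      intro s a
      rw [hQ]
      refine M.abs_daseStep_le hγ0 (fun b => hη01 t b ω) (fun b => hlam01 t b ω) _ ih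
        (fun s a => ?_) s a
      have h2 := (div_le_iff₀ h1).1 (le_max_right Z (R / (1 - γ)))
      linarith [hR s a]
  let c : ℕ → B → S → A → Ω → ℝ := fun t b s a ω =>
    FiniteMDP.stepCoeff i (fun b => owner t b ω) (fun b => st t b ω)
      (fun b => ac t b ω) (fun b => η t b ω) (fun b => lam t b ω) b s a
  have hnoise : ∀ s a b y, ∀ᵐ ω ∂μ, ∃ L, Tendsto (fun n => ∑ t ∈ Finset.range n,
      (γ * c t b s a ω * Finset.univ.sup' Finset.univ_nonempty (Q t ω y)) *
        ((if nx t b ω = y then 1 else 0) - M.p (st t b ω) (ac t b ω) y)) atTop (𝓝 L) := by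
    intro s a b y
    have hset : ∀ t, MeasurableSet[ℱ (t + 1)] {ω | nx t b ω = y} := fun t =>
      hnx t b (show MeasurableSet[⊤] {y} from trivial)
    have hp : ∀ t, Measurable[ℱ t] fun ω => M.p (st t b ω) (ac t b ω) y := fun t =>
      M.measurable_p_comp (hst t b) (hac t b) y
    refine ae_exists_tendsto_sum_of_summable_sq (ℱ := ℱ) (fun t => ?_) (fun t => ?_)
      (fun t ω => ?_) (fun t => ?_) ?_
    · exact ((FiniteMDP.measurable_stepCoeff (howner t) (hst t) (hac t) (hη t) (hlam t)
        b s a).const_mul γ).mul (FiniteMDP.measurable_sup'_table (hQm t) y)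
    · exact (Measurable.ite (hset t) measurable_const measurable_const).sub
        ((hp t).mono (ℱ.mono t.le_succ) le_rfl)
    · have h1 := M.p_nonneg (st t b ω) (ac t b ω) y
      have h2 := M.p_le_one (st t b ω) (ac t b ω) y
      rw [abs_le]
      split_ifs <;> constructor <;> linarith
    · have hpi : Integrable (fun ω => M.p (st t b ω) (ac t b ω) y) μ :=
        Integrable.of_bound ((hp t).mono (ℱ.le t) le_rfl).aestronglyMeasurable 1
          (Eventually.of_forall fun ω => by
            rw [Real.norm_eq_abs, abs_of_nonneg (M.p_nonneg _ _ _)]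
            exact M.p_le_one _ _ _)
      have hi : Integrable (Set.indicator {ω | nx t b ω = y} (fun _ => (1 : ℝ))) μ :=
        (integrable_const 1).indicator (ℱ.le (t + 1) _ (hset t))
      have h1 := condExp_sub hi hpi (ℱ t)
      rw [condExp_of_stronglyMeasurable (ℱ.le t) (hp t).stronglyMeasurable hpi] at h1
      have h2 : (fun ω => (if nx t b ω = y then (1 : ℝ) else 0) - M.p (st t b ω) (ac t b ω) y) =
          Set.indicator {ω | nx t b ω = y} (fun _ => (1 : ℝ)) -
            fun ω => M.p (st t b ω) (ac t b ω) y := by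
        ext ω
        simp [Set.indicator_apply]
      rw [h2]
      filter_upwards [h1, hsample t b y] with ω h3 h4
      rw [h3, Pi.sub_apply, h4, sub_self, Pi.zero_apply]
    · filter_upwards [hsq s a] with ω h
      obtain ⟨C, hC⟩ := hbdd ω
      refine Summable.of_nonneg_of_le (fun _ => sq_nonneg _) (fun t => ?_) (h.mul_left (C ^ 2))
      have h1 : |Finset.univ.sup' Finset.univ_nonempty (Q t ω y)| ≤ C :=
        Finset.abs_sup'_le _ fun a' _ => hC t y a'
      have h2 : Finset.univ.sup' Finset.univ_nonempty (Q t ω y) ^ 2 ≤ C ^ 2 :=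
        sq_le_sq' (abs_le.1 h1).1 (abs_le.1 h1).2
      have h3 : c t b s a ω ^ 2 ≤ _ := FiniteMDP.stepCoeff_sq_le
        (fun b => hη01 t b ω) (fun b => hlam01 t b ω) b s a
      have h4 : γ ^ 2 ≤ 1 := pow_le_one₀ hγ0 hγ1.le
      calc _ = γ ^ 2 * (Finset.univ.sup' Finset.univ_nonempty (Q t ω y) ^ 2 *
            c t b s a ω ^ 2) := by ring
        _ ≤ 1 * (C ^ 2 * _) := by gcongr
        _ = _ := one_mul _
  filter_upwards [ae_all_iff.2 fun s => ae_all_iff.2 fun a => hdiv s a,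
    ae_all_iff.2 fun s => ae_all_iff.2 fun a => ae_all_iff.2 fun b => ae_all_iff.2 fun y =>
      hnoise s a b y] with ω hd hn
  obtain ⟨C, hC⟩ := hbdd ω
  refine M.tendsto_qStar_of_tendsto_sum_noise hγ0 hγ1 (α := fun t s a => ∑ b, c t b s a ω) hC
    (fun t s a => FiniteMDP.sum_stepCoeff_mem_Icc (fun b => hη01 t b ω) (fun b => hlam01 t b ω)
      s a) (fun s a => ?_) (fun s a => ?_)
  -- An empty batch would give the factor `(card B)⁻¹ = 0`; divergence of the internal rates
  -- excludes it.
  · have hB : Nonempty B := by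
      by_contra hB
      rw [not_nonempty_iff] at hB
      have := hd s a
      simp only [Finset.univ_eq_empty, Finset.sum_empty, Finset.sum_const_zero] at this
      exact not_tendsto_const_atTop _ _ this
    have hcard : (0 : ℝ) < (Fintype.card B : ℝ)⁻¹ := by
      have := Fintype.card_pos (α := B)
      positivity
    refine tendsto_atTop_mono (fun n => ?_) ((hd s a).const_mul_atTop hcard)
    rw [Finset.mul_sum]
    exact Finset.sum_le_sum fun t _ => FiniteMDP.mul_sum_internal_le_sum_stepCoeff
      (fun b => hη01 t b ω) (fun b => hlam01 t b ω) s a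
  · choose L hL using hn s a
    refine ⟨∑ b, ∑ y, L b y, (tendsto_finsetSum _ fun b _ => tendsto_finsetSum _ fun y _ =>
      hL b y).congr fun n => ?_⟩
    simp only [hQ, c, M.daseStep_sub_bellman_eq]
    rw [Finset.sum_comm' (t' := Finset.univ) (s' := fun _ => Finset.range n) (by simp)]
    refine Finset.sum_congr rfl fun b _ => ?_
    rw [Finset.sum_comm]
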